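/- Let $N\ge 2$ and $L\ge 1$ be integers, let $U_1,\dots,U_L$ be unitary $N\times N$ matrices (describing $L$ orthonormal bases of $\mathbb{C}^N$), and for a unit vector $\psi\in\mathbb{C}^N$ put $p^{(k)}_i=|\langle i|U_k|\psi\rangle|^2$ and $S_k=-\sum_{i=1}^N p^{(k)}_i\log p^{(k)}_i$. Let $\sigma_1,\dots,\sigma_{N^2-1}$ be traceless Hermitian $N\times N$ matrices with $\operatorname{Tr}(\sigma_i\sigma_j)=2\delta_{ij}$, let $M$ be the Hermitian matrix with entries $$M_{j'j}=\sum_{k=1}^{L}\sum_{i=1}^{N}\operatorname{Tr}\left(U_k^\dagger|i\rangle\langle i|U_k\sigma_{j'}\right)\operatorname{Tr}\left(U_k^\dagger|i\rangle\langle i|U_k\sigma_{j}\right),$$ let $\mathcal M_{\min}$, $\mathcal M_{\max}$ be its minimal and maximal eigenvalues, and let $$\mathcal P_{\min/\max}=\frac1{LN}+\frac{N-1}{2NL^2}\,\mathcal M_{\min/\max}.$$ Define $$B_{\min}=L\mathcal P_{\max}\left[a(K+1)\log(K+1)+(1-a)K\log K\right],\qquad K=\left\lfloor (L\mathcal P_{\max})^{-1}\right\rfloor,\quad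 a=(L\mathcal P_{\max})^{-1}-K,$$ $$B_{\max}=S(Q)-\log L,\qquad Q=\frac1{LN}\Big(1+(LN-1)\sqrt r,\underbrace{1-\sqrt r,\dots,1-\sqrt r}_{LN-1}\Big),\qquad r=\frac{LN\mathcal P_{\min}-1}{LN-1},$$ where $S(Q)$ is the Shannon entropy of $Q$. These quantities are well defined: $\mathcal P_{\max}>0$, $0\le r\le 1$, and $Q$ is a probability vector. Moreover, for every unit vector $\psi\in\mathbb{C}^N$, $$0\le B_{\min}\le\frac1L\sum_{k=1}^{L}S_k\le B_{\max}\le\log N .$$ The upper bound is nontrivial, that is $B_{\max}<\log N$, if and only if $\mathcal M_{\min}>0$. It is trivial, $B_{\max}=\log N$, whenever $L\le N$ (in particular for $L\le 2$), while for every $L\ge 3$ it is nontrivial for suitable bases: there are $L$ bases of $\mathbb{C}^2$ with $B_{\max}<\log 2$. -/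

import Mathlib

open scoped Matrix

noncomputable section

namespace QuantumCertainty

/-- Shannon entropy `-∑ p log p` (natural logarithm, `0 log 0 = 0`) of a finite vector. -/
def shannonEntropy {ι : Type*} [Fintype ι] (p : ι → ℝ) : ℝ :=
  ∑ i, Real.negMulLog (p i)

/-- The outcome probabilities `p_i = |⟨i|U|ψ⟩|²`. -/
def outcomeProb {N : ℕ} (U : Matrix.unitaryGroup (Fin N) ℂ)
    (ψ : EuclideanSpace ℂ (Fin N)) (i : Fin N) : ℝ :=
  ‖((U : Matrix (Fin N) (Fin N) ℂ) *ᵥ ψ.ofLp) i‖ ^ 2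

/-- The average `(1/L) ∑ₖ Sₖ` of the Shannon entropies of the `L` measurements. -/
def averageEntropy {N L : ℕ} (U : Fin L → Matrix.unitaryGroup (Fin N) ℂ)
    (ψ : EuclideanSpace ℂ (Fin N)) : ℝ :=
  (1 / (L : ℝ)) * ∑ k, shannonEntropy (outcomeProb (U k) ψ)

/-- A system of generators of `SU(N)`: `N² - 1` traceless Hermitian matrices with
`Tr (σᵢ σⱼ) = 2 δᵢⱼ` (the Pauli matrices are an example for `N = 2`). -/
structure IsSUGenerators {N : ℕ} (σ : Fin (N ^ 2 - 1) → Matrix (Fin N) (Fin N) ℂ) : Prop where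
  isHermitian : ∀ j, (σ j).IsHermitian
  trace_eq_zero : ∀ j, (σ j).trace = 0
  trace_mul : ∀ i j, (σ i * σ j).trace = if i = j then 2 else 0

/-- The projector `U† |i⟩⟨i| U`. -/
def measProj {N : ℕ} (U : Matrix.unitaryGroup (Fin N) ℂ) (i : Fin N) :
    Matrix (Fin N) (Fin N) ℂ :=
  (U : Matrix (Fin N) (Fin N) ℂ)ᴴ * Matrix.single i i (1 : ℂ) * (U : Matrix (Fin N) (Fin N) ℂ)

/-- The matrix `M_{j'j} = ∑ₖ ∑ᵢ Tr (Uₖ† |i⟩⟨i| Uₖ σ_{j'}) Tr (Uₖ† |i⟩⟨i| Uₖ σ_j)`. -/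
def blochMatrix {N L : ℕ} (U : Fin L → Matrix.unitaryGroup (Fin N) ℂ)
    (σ : Fin (N ^ 2 - 1) → Matrix (Fin N) (Fin N) ℂ) :
    Matrix (Fin (N ^ 2 - 1)) (Fin (N ^ 2 - 1)) ℂ :=
  Matrix.of fun j' j => ∑ k, ∑ i,
    (measProj (U k) i * σ j').trace * (measProj (U k) i * σ j).trace

/-- The minimal eigenvalue of `M` (`M` is Hermitian, so its eigenvalues are real). -/
def eigMin {N L : ℕ} (U : Fin L → Matrix.unitaryGroup (Fin N) ℂ)
    (σ : Fin (N ^ 2 - 1) → Matrix (Fin N) (Fin N) ℂ) : ℝ :=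
  sInf (spectrum ℝ (blochMatrix U σ))

/-- The maximal eigenvalue of `M`. -/
def eigMax {N L : ℕ} (U : Fin L → Matrix.unitaryGroup (Fin N) ℂ)
    (σ : Fin (N ^ 2 - 1) → Matrix (Fin N) (Fin N) ℂ) : ℝ :=
  sSup (spectrum ℝ (blochMatrix U σ))

/-- `1/(LN) + ((N-1)/(2NL²)) m`. -/
def purityOf (N L : ℕ) (m : ℝ) : ℝ :=
  1 / ((L : ℝ) * N) + (((N : ℝ) - 1) / (2 * N * (L : ℝ) ^ 2)) * m

/-- `P_min`. -/
def purityMin {N L : ℕ} (U : Fin L → Matrix.unitaryGroup (Fin N) ℂ)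
    (σ : Fin (N ^ 2 - 1) → Matrix (Fin N) (Fin N) ℂ) : ℝ :=
  purityOf N L (eigMin U σ)

/-- `P_max`. -/
def purityMax {N L : ℕ} (U : Fin L → Matrix.unitaryGroup (Fin N) ℂ)
    (σ : Fin (N ^ 2 - 1) → Matrix (Fin N) (Fin N) ℂ) : ℝ :=
  purityOf N L (eigMax U σ)

/-- `c [a (K+1) log (K+1) + (1-a) K log K]` with `K = ⌊c⁻¹⌋` and `a = c⁻¹ - K`. -/
def lowerEntropyBound (c : ℝ) : ℝ :=
  let K : ℕ := ⌊c⁻¹⌋₊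
  let a : ℝ := c⁻¹ - K
  c * (a * ((K : ℝ) + 1) * Real.log ((K : ℝ) + 1) + (1 - a) * K * Real.log K)

/-- The lower bound `B_min`, which is the expression above at `c = L P_max`. -/
def Bmin {N L : ℕ} (U : Fin L → Matrix.unitaryGroup (Fin N) ℂ)
    (σ : Fin (N ^ 2 - 1) → Matrix (Fin N) (Fin N) ℂ) : ℝ :=
  lowerEntropyBound ((L : ℝ) * purityMax U σ)

/-- `r = (LN P_min - 1)/(LN - 1)`. -/
def rParam {N L : ℕ} (U : Fin L → Matrix.unitaryGroup (Fin N) ℂ)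
    (σ : Fin (N ^ 2 - 1) → Matrix (Fin N) (Fin N) ℂ) : ℝ :=
  ((L : ℝ) * N * purityMin U σ - 1) / ((L : ℝ) * N - 1)

/-- The vector `(1/(LN)) (1 + (LN-1) √r, 1 - √r, …, 1 - √r)` of length `LN`. -/
def Qvec (N L : ℕ) (r : ℝ) (j : Fin (L * N)) : ℝ :=
  (1 / ((L : ℝ) * N)) *
    (if (j : ℕ) = 0 then 1 + ((L : ℝ) * N - 1) * Real.sqrt r else 1 - Real.sqrt r)

/-- The upper bound `B_max = S(Q) - log L`. -/
def Bmax {N L : ℕ} (U : Fin L → Matrix.unitaryGroup (Fin N) ℂ)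
    (σ : Fin (N ^ 2 - 1) → Matrix (Fin N) (Fin N) ℂ) : ℝ :=
  shannonEntropy (Qvec N L (rParam U σ)) - Real.log L

end QuantumCertainty

end

/-! Everything passes through the sum of squared probabilities (the index of coincidence). For a
pure state `ρ = |ψ⟩⟨ψ|` the traceless matrix `ρ - 1/N` has a coordinate vector `v` in the
generators, of squared length `(N-1)/(2N)` because `Tr ρ² = 1`. The deviations `p_i^{(k)} - 1/N` are
the entries of `C v`, where `C` is `blochCoord`, and `M = Cᴴ C`. Hence `∑ₖ ∑ᵢ (p_i^{(k)})² = L/N +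
⟨v, M v⟩`, and the Rayleigh bounds place it between `L² P_min` and `L² P_max`
(`sum_sq_outcomeProb_bounds`).

Lower bound: entropy is at least an affine, decreasing function of the index of coincidence
(`le_shannonEntropy`). Being affine, it can be averaged over the bases; `K = ⌊(L P_max)⁻¹⌋` selects
the chord whose value at `L P_max` is `B_min`.

Upper bound: the vector of all `p_i^{(k)} / L` is a distribution on `LN` points with entropy `(1/L)
∑ Sₖ + log L` and index of coincidence at least `P_min`. Under that constraint entropy is largest at
a vector `(u, v, …, v)` (`shannonEntropy_le_of_sum_sq`), and `r` is chosen so that `Q` is that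
vector.

Since `0 ≤ M ≤ 2L`, all parameters are in range. `Q` is uniform exactly when `r = 0`, that is when
`M` is singular. A dimension count makes `M` singular for `L ≤ N`; three qubit bases with
independent Bloch axes make it invertible. -/

noncomputable section
-- Minimal entropy at a given index of coincidence.
namespace QuantumCertainty
open Real Finset

/-- A strict-convexity argument: the sum `g s + g (c - s)`, `g s = -s log s + β s ^ 2`, has no
minimizer on `[0, c]` strictly between an endpoint and the midpoint. -/
theorem exists_better_pair (β : ℝ) {x y : ℝ} (hx : 0 < x) (hxy : x < y) :
    negMulLog (x + y) + β * (x + y) ^ 2 <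
        negMulLog x + β * x ^ 2 + (negMulLog y + β * y ^ 2) ∨
      negMulLog ((x + y) / 2) + β * ((x + y) / 2) ^ 2 +
          (negMulLog ((x + y) / 2) + β * ((x + y) / 2) ^ 2) <
        negMulLog x + β * x ^ 2 + (negMulLog y + β * y ^ 2) := by
  by_contra! hcon
  obtain ⟨h0, hm⟩ := hcon
  obtain ⟨c, hc⟩ : ∃ c, c = x + y := ⟨_, rfl⟩
  obtain rfl : y = c - x := by linarith
  rw [← hc] at h0 hm
  set ψ : ℝ → ℝ := fun s =>
    negMulLog s + β * s ^ 2 + (negMulLog (c - s) + β * (c - s) ^ 2) with hψ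
  set ψ' : ℝ → ℝ := fun s => log (c - s) - log s + 2 * β * (2 * s - c) with hψ'
  have hd : ∀ s, 0 < s → s < c → HasDerivAt ψ (ψ' s) s := by
    intro s hs hsc
    have h1 := hasDerivAt_negMulLog hs.ne'
    have h3 : HasDerivAt (fun s : ℝ => c - s) (-1) s := by
      simpa using (hasDerivAt_id s).const_sub c
    have h2 := (hasDerivAt_negMulLog (x := c - s) (by linarith)).comp s h3
    have h4 := ((hasDerivAt_id s).pow 2).const_mul β
    have h5 := (h3.pow 2).const_mul β
    have := (h1.add h4).add (h2.add h5)
    refine this.congr_deriv ?_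
    simp [hψ']
    ring
  have hcont : Continuous ψ := by
    have := continuous_negMulLog
    fun_prop
  have hψ0 : ψ x ≤ ψ 0 := by simpa [hψ] using h0
  have hψm : ψ x ≤ ψ (c / 2) := by
    have : c - c / 2 = c / 2 := by ring
    simpa [hψ, this] using hm
  -- If `x` beat both the endpoint and the midpoint, `ψ'` would be `≤ 0` at some `ξ < x`, `≥ 0` at
  -- some `η` in `(x, c/2)`, and `0` at `c/2`; strict convexity of `ψ'` forbids this.
  obtain ⟨ξ, ⟨hξ0, hξx⟩, hξ⟩ := exists_hasDerivAt_eq_slope ψ ψ' hx hcont.continuousOn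
    (fun s hs => hd s hs.1 (by linarith [hs.2]))
  obtain ⟨η, ⟨hηx, hηc⟩, hη⟩ := exists_hasDerivAt_eq_slope ψ ψ' (show x < c / 2 by linarith)
    hcont.continuousOn (fun s hs => hd s (hx.trans hs.1) (by linarith [hs.2]))
  have hξ' : ψ' ξ ≤ 0 := by
    rw [hξ]; exact div_nonpos_of_nonpos_of_nonneg (by linarith) (by linarith)
  have hη' : 0 ≤ ψ' η := by
    rw [hη]; exact div_nonneg (by linarith) (by linarith)
  have hmid : ψ' (c / 2) = 0 := by
    have : c - c / 2 = c / 2 := by ring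
    simp only [hψ', this]; ring
  have hd' : ∀ s, 0 < s → s < c →
      HasDerivAt ψ' (-1 / (c - s) - 1 / s + 2 * β * 2) s := by
    intro s hs hsc
    have h3 : HasDerivAt (fun s : ℝ => c - s) (-1) s := by
      simpa using (hasDerivAt_id s).const_sub c
    have h1 := h3.log (by linarith)
    have h2 := (hasDerivAt_id s).log hs.ne'
    have h4 := ((((hasDerivAt_id s).const_mul 2).sub_const c)).const_mul (2 * β)
    have := (h1.sub h2).add h4
    refine this.congr_deriv ?_
    simp
  have hconv : StrictConvexOn ℝ (Set.Ioc 0 (c / 2)) ψ' := by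
    apply StrictMonoOn.strictConvexOn_of_deriv (convex_Ioc _ _)
    · intro s hs
      exact (hd' s hs.1 (by linarith [hs.2, hs.1])).continuousAt.continuousWithinAt
    · rw [interior_Ioc]
      intro s hs t ht hst
      have hs1 := hs.1
      have ht2 := ht.2
      rw [(hd' s hs.1 (by linarith)).deriv, (hd' t ht.1 (by linarith)).deriv]
      have hcs : 0 < c - s := by linarith
      have hct : 0 < c - t := by linarith
      have ht0 : 0 < t := ht.1
      have e1 : -1 / (c - s) - 1 / s = -(c / (s * (c - s))) := by
        field_simp; ring
      have e2 : -1 / (c - t) - 1 / t = -(c / (t * (c - t))) := by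
        field_simp; ring
      rw [e1, e2]
      have : c / (t * (c - t)) < c / (s * (c - s)) := by
        apply div_lt_div_of_pos_left (by linarith) (by positivity)
        nlinarith
      linarith
  have := hconv.lt_on_openSegment (x := ξ) (y := c / 2) (z := η) ⟨hξ0, by linarith⟩
    ⟨by linarith, le_rfl⟩ (by linarith) (by
      rw [openSegment_eq_Ioo (by linarith)]; exact ⟨by linarith, hηc⟩)
  rw [hmid, max_eq_right hξ'] at this
  linarith

/-- With `φ x = -log x + β x`, the two sides are `φ (1/K)` and `φ (1/n)`. This `β` makes `φ` equal
at `1/K` and `1/(K+1)`; by convexity `φ` is no smaller outside that interval, and no `1/n` lies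
strictly inside it. -/
theorem log_add_div_le {K n : ℕ} (hK : 1 ≤ K) (hn : 1 ≤ n) {β : ℝ}
    (hβ : β = K * (K + 1) * log ((K + 1) / K)) :
    log K + β / K ≤ log n + β / n := by
  have hK0 : (0 : ℝ) < K := by exact_mod_cast hK
  have hn0 : (0 : ℝ) < n := by exact_mod_cast hn
  set φ : ℝ → ℝ := fun x => -log x + β * x with hφ
  have hconv : ConvexOn ℝ (Set.Ioi 0) φ := by
    apply ConvexOn.add strictConcaveOn_log_Ioi.concaveOn.neg
    exact (β • (LinearMap.id : ℝ →ₗ[ℝ] ℝ)).convexOn (convex_Ioi 0)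
  have hval : ∀ m : ℝ, φ m⁻¹ = log m + β / m := by
    intro m; simp [hφ, log_inv, div_eq_mul_inv]
  have heq : log (K : ℝ) + β / K = log (K + 1 : ℝ) + β / (K + 1) := by
    rw [hβ, log_div (by positivity) (by positivity)]
    field_simp
    ring
  rcases lt_trichotomy n K with h | h | h
  · rw [← hval, ← hval]
    have h' : (n : ℝ) < K := by exact_mod_cast h
    refine hconv.le_right_of_left_le (x := ((K : ℝ) + 1)⁻¹) (y := (n : ℝ)⁻¹) (z := (K : ℝ)⁻¹)
      (Set.mem_Ioi.2 (by positivity)) (Set.mem_Ioi.2 (by positivity)) ?_ ?_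
    · rw [openSegment_eq_Ioo]
      · exact ⟨by gcongr; linarith, by gcongr⟩
      · gcongr; linarith
    · rw [hval, hval, heq]
  · rw [h]
  · rcases Nat.lt_or_ge (K + 1) n with h2 | h2
    · rw [heq, ← hval, ← hval]
      have h' : (K : ℝ) + 1 < n := by exact_mod_cast h2
      refine hconv.le_right_of_left_le (x := (K : ℝ)⁻¹) (y := (n : ℝ)⁻¹) (z := ((K : ℝ) + 1)⁻¹)
        (Set.mem_Ioi.2 (by positivity)) (Set.mem_Ioi.2 (by positivity)) ?_ ?_
      · rw [openSegment_symm, openSegment_eq_Ioo]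
        · exact ⟨by gcongr, by gcongr; linarith⟩
        · gcongr
      · rw [hval, hval, heq]
    · obtain rfl : n = K + 1 := by omega
      rw [heq]; push_cast; rfl

theorem sum_update_update {ι : Type*} [Fintype ι] [DecidableEq ι] (g : ℝ → ℝ) (p : ι → ℝ)
    {i j : ι} (hij : i ≠ j) (a b : ℝ) :
    ∑ k, g (Function.update (Function.update p i a) j b k) =
      ∑ k, g (p k) - g (p i) - g (p j) + g a + g b := by
  have e1 : ∀ q : ι → ℝ, ∑ k, g (q k) = g (q j) + (g (q i) +
      ∑ k ∈ (univ.erase j).erase i, g (q k)) := by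
    intro q
    rw [add_sum_erase _ (fun k => g (q k)) (by simp [hij]),
      add_sum_erase _ (fun k => g (q k)) (mem_univ _)]
  rw [e1, e1 p]
  have : ∑ k ∈ (univ.erase j).erase i, g (Function.update (Function.update p i a) j b k) =
      ∑ k ∈ (univ.erase j).erase i, g (p k) := by
    apply sum_congr rfl
    intro k hk
    simp only [mem_erase] at hk
    rw [Function.update_of_ne hk.2.1, Function.update_of_ne hk.1]
  rw [this, Function.update_self, Function.update_of_ne hij, Function.update_self]
  ring

/-- The lower bound of Harremoës and Topsøe on the entropy at a given index of coincidence. -/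
theorem le_shannonEntropy {ι : Type*} [Fintype ι] {p : ι → ℝ} (hp : p ∈ stdSimplex ℝ ι)
    {K : ℕ} (hK : 1 ≤ K) {β : ℝ} (hβ : β = K * (K + 1) * log ((K + 1) / K)) :
    log K + β / K - β * ∑ i, p i ^ 2 ≤ shannonEntropy p := by
  classical
  set g : ℝ → ℝ := fun s => negMulLog s + β * s ^ 2 with hg
  have hgc : Continuous g := by
    have := continuous_negMulLog
    fun_prop
  have hcont : Continuous fun q : ι → ℝ => ∑ i, g (q i) := by fun_prop
  obtain ⟨q, hq, hmin⟩ := (isCompact_stdSimplex ℝ ι).exists_isMinOn ⟨p, hp⟩ hcont.continuousOn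
  have hle := hmin hp
  have hsum : ∑ i, g (p i) = shannonEntropy p + β * ∑ i, p i ^ 2 := by
    simp only [hg, sum_add_distrib, shannonEntropy, mul_sum]
  simp only [Set.mem_ofPred_eq, hsum] at hle
  suffices h : log K + β / K ≤ ∑ i, g (q i) by linarith
  -- Two unequal positive entries of the minimizer could be merged or equalized, keeping their sum
  -- and lowering the objective.
  have hpair : ∀ i j, 0 < q i → ¬ q i < q j := by
    intro i j hi hlt
    have hij : i ≠ j := by rintro rfl; exact lt_irrefl _ hlt
    have key : ∀ a b, 0 ≤ a → 0 ≤ b → a + b = q i + q j → g (q i) + g (q j) ≤ g a + g b := by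
      intro a b ha hb hab
      have hmem : Function.update (Function.update q i a) j b ∈ stdSimplex ℝ ι := by
        refine ⟨fun k => ?_, ?_⟩
        · rw [Function.update_apply, Function.update_apply]
          split_ifs
          exacts [hb, ha, hq.1 k]
        · have := sum_update_update id q hij a b
          simp only [id] at this
          rw [this, hq.2]; linarith
      have := hmin hmem
      simp only [Set.mem_ofPred_eq] at this
      rw [sum_update_update g q hij] at this
      linarith
    rcases exists_better_pair β hi hlt with h | h
    · have := key 0 (q i + q j) le_rfl (by linarith) (by ring)
      simp only [hg, negMulLog_zero] at this
      linarith
    · have := key ((q i + q j) / 2) ((q i + q j) / 2) (by linarith) (by linarith) (by ring)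
      simp only [hg] at this
      linarith
  -- So the minimizer is uniform on its support, and only the size of the support is left to
  -- optimize.
  set s : Finset ι := univ.filter fun i => 0 < q i with hs
  have hout : ∀ i ∉ s, q i = 0 := by
    intro i hi
    have : ¬ 0 < q i := by simpa [hs] using hi
    exact le_antisymm (not_lt.1 this) (hq.1 i)
  have hsum1 : ∑ i ∈ s, q i = 1 := by
    rw [← hq.2]
    exact sum_subset (subset_univ _) fun i _ hi => hout i hi
  have hne : s.Nonempty := by
    rw [nonempty_iff_ne_empty]
    intro h
    rw [h] at hsum1
    simp at hsum1
  obtain ⟨i₀, hi₀⟩ := hne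
  have hpos : ∀ i ∈ s, 0 < q i := by intro i hi; simpa [hs] using hi
  have hconst : ∀ i ∈ s, q i = q i₀ := fun i hi =>
    le_antisymm (not_lt.1 (hpair _ _ (hpos _ hi₀))) (not_lt.1 (hpair _ _ (hpos _ hi)))
  have hn : 1 ≤ s.card := card_pos.2 ⟨i₀, hi₀⟩
  have hn0 : (0 : ℝ) < s.card := by exact_mod_cast hn
  have hq0 : q i₀ = (s.card : ℝ)⁻¹ := by
    rw [sum_congr rfl hconst, sum_const, nsmul_eq_mul] at hsum1
    exact eq_inv_of_mul_eq_one_right hsum1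
  have hfin : ∑ i, g (q i) = log s.card + β / s.card := by
    rw [← sum_subset (subset_univ s) (fun i _ hi => by simp [hg, hout i hi]),
      sum_congr rfl (fun i hi => by rw [hconst i hi]), sum_const, nsmul_eq_mul, hq0]
    simp only [hg, negMulLog, log_inv]
    field_simp
  rw [hfin]
  exact log_add_div_le hK hn hβ

/-! ### Maximal entropy, with and without a bound on the index of coincidence. -/

theorem shannonEntropy_le_log_card {ι : Type*} [Fintype ι] [Nonempty ι] {p : ι → ℝ}
    (hp : p ∈ stdSimplex ℝ ι) : shannonEntropy p ≤ log (Fintype.card ι) := by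
  have hn : (0 : ℝ) < Fintype.card ι := by exact_mod_cast Fintype.card_pos
  have := concaveOn_negMulLog.le_map_sum (t := univ) (w := fun _ : ι => (Fintype.card ι : ℝ)⁻¹)
    (p := p) (fun _ _ => by positivity) (by simp [hn.ne']) (fun i _ => hp.1 i)
  simp only [smul_eq_mul, ← mul_sum, hp.2] at this
  rw [mul_one, negMulLog, log_inv] at this
  change (Fintype.card ι : ℝ)⁻¹ * shannonEntropy p ≤ _ at this
  have h2 := mul_le_mul_of_nonneg_left this hn.le
  field_simp at h2
  linarith

theorem shannonEntropy_lt_log_card {ι : Type*} [Fintype ι] [Nonempty ι] {p : ι → ℝ}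
    (hp : p ∈ stdSimplex ℝ ι) {i j : ι} (hij : p i ≠ p j) :
    shannonEntropy p < log (Fintype.card ι) := by
  have hn : (0 : ℝ) < Fintype.card ι := by exact_mod_cast Fintype.card_pos
  have := strictConcaveOn_negMulLog.lt_map_sum (t := univ)
    (w := fun _ : ι => (Fintype.card ι : ℝ)⁻¹) (p := p) (fun _ _ => by positivity)
    (by simp [hn.ne']) (fun i _ => hp.1 i) ⟨i, mem_univ _, j, mem_univ _, hij⟩
  simp only [smul_eq_mul, ← mul_sum, hp.2] at this
  rw [mul_one, negMulLog, log_inv] at this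
  change (Fintype.card ι : ℝ)⁻¹ * shannonEntropy p < _ at this
  have h2 := mul_lt_mul_of_pos_left this hn
  field_simp at h2
  linarith

theorem negMulLog_le_tangent {v q : ℝ} (hv : 0 < v) (hq : 0 ≤ q) :
    negMulLog q ≤ negMulLog v + (-log v - 1) * (q - v) := by
  rcases hq.eq_or_lt with rfl | hq
  · simp [negMulLog]; nlinarith
  · have := log_le_sub_one_of_pos (div_pos hv hq)
    rw [log_div hv.ne' hq.ne'] at this
    have h2 := mul_le_mul_of_nonneg_left this hq.le
    have h3 : q * (v / q - 1) = v - q := by field_simp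
    simp only [negMulLog]
    nlinarith

/-- The quadratic that agrees with `negMulLog` to first order at `v` and to order zero at `u`
dominates it on `[0, u]`. -/
theorem negMulLog_le_hermite {u v q C : ℝ} (hv : 0 < v) (hvu : v < u) (hq : 0 ≤ q) (hqu : q ≤ u)
    (hC : negMulLog v + (-log v - 1) * (u - v) - C * (u - v) ^ 2 = negMulLog u) :
    negMulLog q ≤ negMulLog v + (-log v - 1) * (q - v) - C * (q - v) ^ 2 := by
  set χ : ℝ → ℝ := fun q =>
    negMulLog v + (-log v - 1) * (q - v) - C * (q - v) ^ 2 - negMulLog q with hχ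
  set χ' : ℝ → ℝ := fun q => log q - log v - 2 * C * (q - v) with hχ'
  have hcont : Continuous χ := by
    have := continuous_negMulLog
    fun_prop
  have hd : ∀ s, 0 < s → HasDerivAt χ (χ' s) s := by
    intro s hs
    have h0 := (hasDerivAt_id s).sub_const v
    have h1 := hasDerivAt_negMulLog hs.ne'
    have := (((h0.const_mul (-log v - 1)).const_add (negMulLog v)).sub
      ((h0.pow 2).const_mul C)).sub h1
    refine this.congr_deriv ?_
    simp [hχ']
    ring
  have hχv : χ v = 0 := by simp [hχ]
  have hχu : χ u = 0 := by simp only [hχ]; linarith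
  have hχ'v : χ' v = 0 := by simp [hχ']
  have hconc : StrictConcaveOn ℝ (Set.Ioi 0) χ' := by
    refine (strictConcaveOn_log_Ioi.add_concaveOn
      (g := fun q => -log v - 2 * C * (q - v)) ?_).congr ?_
    · refine ⟨convex_Ioi _, fun x _ y _ a b _ _ hab => le_of_eq ?_⟩
      obtain rfl : b = 1 - a := by linarith
      simp only [smul_eq_mul]; ring
    · intro s _; simp only [hχ', Pi.add_apply]; ring
  suffices h : 0 ≤ χ q by simp only [hχ] at h; linarith
  -- Rolle gives a second zero `m` of the strictly concave `χ'` besides `v`. A negative value of `χ`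
  -- on either side of `v` would then contradict concavity through the mean value theorem.
  obtain ⟨m, ⟨hvm, hmu⟩, hm⟩ := exists_hasDerivAt_eq_zero (f := χ) (f' := χ') hvu
    hcont.continuousOn (by rw [hχv, hχu]) (fun s hs => hd s (hv.trans hs.1))
  by_contra! hneg
  rcases lt_trichotomy q v with h | h | h
  · obtain ⟨ξ, ⟨h1, h2⟩, hξ⟩ := exists_hasDerivAt_eq_slope χ χ' h hcont.continuousOn
      (fun s hs => hd s (hq.trans_lt hs.1))
    have hξ' : 0 < χ' ξ := by
      rw [hξ]; exact div_pos (by linarith) (by linarith)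
    have := hconc.lt_on_openSegment (x := ξ) (y := m) (z := v) (hq.trans_lt h1)
      (hv.trans hvm) (by linarith) (by
        rw [openSegment_eq_Ioo (by linarith)]; exact ⟨h2, hvm⟩)
    rw [hm, min_eq_right hξ'.le] at this
    linarith
  · rw [h] at hneg; linarith
  · have hqu' : q < u := by
      rcases hqu.eq_or_lt with h | h
      · rw [h] at hneg; linarith
      · exact h
    obtain ⟨ξ, ⟨h1, h2⟩, hξ⟩ := exists_hasDerivAt_eq_slope χ χ' h hcont.continuousOn
      (fun s hs => hd s (hv.trans hs.1))
    obtain ⟨η, ⟨h3, h4⟩, hη⟩ := exists_hasDerivAt_eq_slope χ χ' hqu' hcont.continuousOn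
      (fun s hs => hd s (hv.trans (h.trans hs.1)))
    have hξ' : χ' ξ < 0 := by
      rw [hξ]; exact div_neg_of_neg_of_pos (by linarith) (by linarith)
    have hη' : 0 < χ' η := by
      rw [hη]; exact div_pos (by linarith) (by linarith)
    have := hconc.lt_on_openSegment (x := v) (y := η) (z := ξ) hv
      (Set.mem_Ioi.2 (by linarith)) (by linarith) (by
        rw [openSegment_eq_Ioo (by linarith)]; exact ⟨h1, by linarith⟩)
    rw [hχ'v, min_eq_left hη'.le] at this
    linarith

/-- Among the probability vectors with at least a given index of coincidence, the entropy is
maximal at a vector of the form `(u, v, …, v)` with `v ≤ u`. -/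
theorem shannonEntropy_le_of_sum_sq {ι : Type*} [Fintype ι] {q : ι → ℝ}
    (hq : q ∈ stdSimplex ℝ ι) {u v : ℝ} (hv : 0 < v) (hvu : v < u)
    (huv : u + (Fintype.card ι - 1) * v = 1)
    (hsq : u ^ 2 + (Fintype.card ι - 1) * v ^ 2 ≤ ∑ i, q i ^ 2) :
    shannonEntropy q ≤ negMulLog u + (Fintype.card ι - 1) * negMulLog v := by
  classical
  -- An entry `≥ u` lies outside the range of the quadratic majorant. There tangent lines suffice:
  -- at `u` for that entry and at `v` for the others, with total error `(q i - u) (log v - log u) ≤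
  -- 0`.
  by_cases h : ∃ i, u ≤ q i
  · obtain ⟨i, hi⟩ := h
    have e1 : shannonEntropy q = negMulLog (q i) + ∑ k ∈ univ.erase i, negMulLog (q k) := by
      rw [add_sum_erase _ (fun k => negMulLog (q k)) (mem_univ i)]; rfl
    have e2 : ∑ k ∈ univ.erase i, q k = 1 - q i := by
      rw [← hq.2, ← add_sum_erase _ q (mem_univ i)]; ring
    have h1 : ∑ k ∈ univ.erase i, negMulLog (q k) ≤
        ∑ k ∈ univ.erase i, (negMulLog v + (-log v - 1) * (q k - v)) :=
      sum_le_sum fun k _ => negMulLog_le_tangent hv (hq.1 k)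
    have hcard : ((univ.erase i).card : ℝ) = Fintype.card ι - 1 := by
      rw [card_erase_of_mem (mem_univ i), card_univ, Nat.cast_sub, Nat.cast_one]
      exact Fintype.card_pos_iff.2 ⟨i⟩
    rw [sum_add_distrib, ← mul_sum, sum_sub_distrib, e2, sum_const, sum_const, nsmul_eq_mul,
      nsmul_eq_mul, hcard] at h1
    have h2 := negMulLog_le_tangent (hv.trans hvu) (hq.1 i)
    have h3 : log v ≤ log u := log_le_log hv hvu.le
    have h4 : 1 - q i - (Fintype.card ι - 1) * v = u - q i := by linarith
    rw [h4] at h1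
    rw [e1]
    nlinarith
  · push Not at h
    obtain ⟨C, hC⟩ : ∃ C, negMulLog v + (-log v - 1) * (u - v) - C * (u - v) ^ 2 =
        negMulLog u := by
      refine ⟨(negMulLog v + (-log v - 1) * (u - v) - negMulLog u) / (u - v) ^ 2, ?_⟩
      rw [div_mul_cancel₀ _ (pow_ne_zero _ (by linarith))]; ring
    -- The sign of `C` is what makes a lower bound on `∑ q i ^ 2` an upper bound on the entropy.
    have hC0 : 0 ≤ C := by
      have h1 := negMulLog_le_tangent hv (hv.trans hvu).le
      have h2 : 0 ≤ C * (u - v) ^ 2 := by linarith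
      exact nonneg_of_mul_nonneg_left h2 (pow_pos (by linarith) _)
    have h1 : shannonEntropy q ≤
        ∑ k, (negMulLog v + (-log v - 1) * (q k - v) - C * (q k - v) ^ 2) :=
      sum_le_sum fun k _ => negMulLog_le_hermite hv hvu (hq.1 k) (h k).le hC
    have e : ∀ k, (q k - v) ^ 2 = q k ^ 2 - 2 * v * q k + v ^ 2 := fun k => by ring
    simp only [e] at h1
    simp only [sum_add_distrib, sum_sub_distrib, ← mul_sum, sum_const, card_univ, nsmul_eq_mul,
      hq.2] at h1
    have h2 : (u - v) ^ 2 = u ^ 2 + (Fintype.card ι - 1) * v ^ 2 - 2 * v +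
        Fintype.card ι * v ^ 2 := by linear_combination (-2 * v) * huv
    have h3 : 1 - (Fintype.card ι : ℝ) * v = u - v := by linarith
    rw [h3] at h1
    rw [h2] at hC
    linarith [mul_le_mul_of_nonneg_left hsq hC0]

end QuantumCertainty
end

noncomputable section
namespace QuantumCertainty

open Finset Matrix

/-! ### Coordinates of traceless matrices. -/

section Generators

variable {N : ℕ} {σ : Fin (N ^ 2 - 1) → Matrix (Fin N) (Fin N) ℂ}

/-- The traceless matrix with coordinates `v` with respect to `σ`. -/
def blochSum (σ : Fin (N ^ 2 - 1) → Matrix (Fin N) (Fin N) ℂ) (v : Fin (N ^ 2 - 1) → ℂ) :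
    Matrix (Fin N) (Fin N) ℂ :=
  ∑ j, v j • σ j

theorem IsSUGenerators.trace_blochSum_mul (hσ : IsSUGenerators σ) (v : Fin (N ^ 2 - 1) → ℂ)
    (i : Fin (N ^ 2 - 1)) : (blochSum σ v * σ i).trace = 2 * v i := by
  simp only [blochSum, sum_mul, trace_sum, smul_mul_assoc, trace_smul, hσ.trace_mul, smul_eq_mul,
    mul_ite, mul_zero, sum_ite_eq', mem_univ, if_true]
  ring

theorem IsSUGenerators.trace_blochSum (hσ : IsSUGenerators σ) (v : Fin (N ^ 2 - 1) → ℂ) :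
    (blochSum σ v).trace = 0 := by
  simp [blochSum, trace_sum, hσ.trace_eq_zero]

theorem IsSUGenerators.trace_conjTranspose_blochSum_mul (hσ : IsSUGenerators σ)
    (v : Fin (N ^ 2 - 1) → ℂ) :
    ((blochSum σ v)ᴴ * blochSum σ v).trace = ((2 * ∑ j, ‖v j‖ ^ 2 : ℝ) : ℂ) := by
  have h : (blochSum σ v)ᴴ = ∑ j, star (v j) • σ j := by
    simp only [blochSum, conjTranspose_sum, conjTranspose_smul, (hσ.isHermitian _).eq]
  rw [trace_mul_comm, h, mul_sum, trace_sum]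
  simp only [mul_smul_comm, trace_smul, hσ.trace_blochSum_mul, smul_eq_mul]
  push_cast
  rw [mul_sum]
  refine sum_congr rfl fun j _ => ?_
  rw [← Complex.conj_mul', starRingEnd_apply]
  ring

/-- By orthogonality the identity and the generators are `N²` independent matrices, hence span;
taking traces removes the identity component. -/
theorem IsSUGenerators.exists_blochSum_eq (hσ : IsSUGenerators σ) (hN : 1 ≤ N)
    {A : Matrix (Fin N) (Fin N) ℂ} (hA : A.trace = 0) : ∃ v, A = blochSum σ v := by
  have hN0 : (N : ℂ) ≠ 0 := by exact_mod_cast (by omega : N ≠ 0)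
  let f : Option (Fin (N ^ 2 - 1)) → Matrix (Fin N) (Fin N) ℂ := fun o => o.elim 1 σ
  have hf : ∀ g : Option (Fin (N ^ 2 - 1)) → ℂ,
      ∑ o, g o • f o = g none • 1 + blochSum σ (fun j => g (some j)) := by
    intro g; rw [Fintype.sum_option]; rfl
  have htr : ∀ g : Option (Fin (N ^ 2 - 1)) → ℂ, (∑ o, g o • f o).trace = 0 → g none = 0 := by
    intro g hg
    rw [hf, trace_add, hσ.trace_blochSum, trace_smul, trace_one] at hg
    simpa [hN0] using hg
  have hli : LinearIndependent ℂ f := by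
    rw [Fintype.linearIndependent_iff]
    intro g hg
    have h0 := htr g (by rw [hg, trace_zero])
    intro o
    cases o with
    | none => exact h0
    | some j =>
      rw [hf, h0, zero_smul, zero_add] at hg
      have := hσ.trace_blochSum_mul (fun j => g (some j)) j
      rw [hg, zero_mul, trace_zero] at this
      simpa using this.symm
  have hspan := hli.span_eq_top_of_card_eq_finrank' (by
    have : 1 ≤ N ^ 2 := Nat.one_le_pow _ _ hN
    rw [Module.finrank_matrix, Fintype.card_option]
    simp only [Fintype.card_fin, Module.finrank_self, mul_one]
    rw [← pow_two]
    omega)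
  have hmem : A ∈ Submodule.span ℂ (Set.range f) := by rw [hspan]; trivial
  obtain ⟨g, hg⟩ := (Submodule.mem_span_range_iff_exists_fun ℂ).1 hmem
  have h0 := htr g (by rw [hg, hA])
  exact ⟨fun j => g (some j), by rw [← hg, hf, h0, zero_smul, zero_add]⟩

end Generators

theorem trace_measProj_mul {N : ℕ} (U : Matrix.unitaryGroup (Fin N) ℂ) (i : Fin N)
    (A : Matrix (Fin N) (Fin N) ℂ) :
    (measProj U i * A).trace =
      ((U : Matrix (Fin N) (Fin N) ℂ) * A * (U : Matrix (Fin N) (Fin N) ℂ)ᴴ) i i := by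
  rw [measProj, Matrix.mul_assoc, Matrix.mul_assoc, trace_mul_comm, Matrix.mul_assoc,
    trace_single_mul]
  simp

theorem unitary_mul_conjTranspose {N : ℕ} (U : Matrix.unitaryGroup (Fin N) ℂ) :
    (U : Matrix (Fin N) (Fin N) ℂ) * (U : Matrix (Fin N) (Fin N) ℂ)ᴴ = 1 :=
  Matrix.mem_unitaryGroup_iff.1 U.2

theorem unitary_conjTranspose_mul {N : ℕ} (U : Matrix.unitaryGroup (Fin N) ℂ) :
    (U : Matrix (Fin N) (Fin N) ℂ)ᴴ * (U : Matrix (Fin N) (Fin N) ℂ) = 1 :=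
  Matrix.mem_unitaryGroup_iff'.1 U.2

theorem sum_unitary_conj_diag {N : ℕ} (U : Matrix.unitaryGroup (Fin N) ℂ)
    (A : Matrix (Fin N) (Fin N) ℂ) :
    ∑ i, ((U : Matrix (Fin N) (Fin N) ℂ) * A * (U : Matrix (Fin N) (Fin N) ℂ)ᴴ) i i =
      A.trace := by
  change trace _ = _
  rw [trace_mul_comm, ← Matrix.mul_assoc, unitary_conjTranspose_mul, Matrix.one_mul]

/-- The diagonal is part of the Hilbert–Schmidt norm. Applied in each basis, this yields `M ≤ 2L`.
-/
theorem sum_normSq_diag_le {N : ℕ} (A : Matrix (Fin N) (Fin N) ℂ) :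
    ∑ i, ‖A i i‖ ^ 2 ≤ (Aᴴ * A).trace.re := by
  have : (Aᴴ * A).trace.re = ∑ i, ∑ j, ‖A j i‖ ^ 2 := by
    simp only [trace, diag_apply, mul_apply, conjTranspose_apply, Complex.re_sum]
    refine sum_congr rfl fun i _ => sum_congr rfl fun j _ => ?_
    rw [← starRingEnd_apply, Complex.conj_mul']
    norm_cast
  rw [this]
  exact sum_le_sum fun i _ =>
    single_le_sum (f := fun j => ‖A j i‖ ^ 2) (fun j _ => by positivity) (mem_univ i)

/-! ### The spectrum of `M` and the Bloch vector of a state. -/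

section Bloch

open scoped ComplexOrder

variable {N L : ℕ} {U : Fin L → Matrix.unitaryGroup (Fin N) ℂ}
  {σ : Fin (N ^ 2 - 1) → Matrix (Fin N) (Fin N) ℂ}

/-- The coordinates `Tr (Uₖ† |i⟩⟨i| Uₖ σ_j)` of the measurement projectors. -/
def blochCoord (U : Fin L → Matrix.unitaryGroup (Fin N) ℂ)
    (σ : Fin (N ^ 2 - 1) → Matrix (Fin N) (Fin N) ℂ) :
    Matrix (Fin L × Fin N) (Fin (N ^ 2 - 1)) ℂ :=
  Matrix.of fun x j => (measProj (U x.1) x.2 * σ j).trace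

theorem blochCoord_mulVec (v : Fin (N ^ 2 - 1) → ℂ) (k : Fin L) (i : Fin N) :
    (blochCoord U σ *ᵥ v) (k, i) = ((U k : Matrix (Fin N) (Fin N) ℂ) * blochSum σ v *
      (U k : Matrix (Fin N) (Fin N) ℂ)ᴴ) i i := by
  rw [← trace_measProj_mul, blochSum, mul_sum, trace_sum]
  simp only [mulVec, dotProduct, blochCoord, of_apply, mul_smul_comm, trace_smul, smul_eq_mul]
  exact sum_congr rfl fun _ _ => mul_comm _ _

/-- The trace of a product of two Hermitian matrices is real, so conjugating the first factor
changes nothing. -/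
theorem IsSUGenerators.blochMatrix_eq (hσ : IsSUGenerators σ) :
    blochMatrix U σ = (blochCoord U σ)ᴴ * blochCoord U σ := by
  have hreal : ∀ k i j, star (measProj (U k) i * σ j).trace = (measProj (U k) i * σ j).trace := by
    intro k i j
    rw [trace_measProj_mul, ← conjTranspose_apply, conjTranspose_mul, conjTranspose_mul,
      conjTranspose_conjTranspose, (hσ.isHermitian j).eq, Matrix.mul_assoc]
  ext j' j
  simp only [blochMatrix, of_apply, mul_apply, conjTranspose_apply, blochCoord, hreal]
  rw [Fintype.sum_prod_type]

theorem IsSUGenerators.posSemidef_blochMatrix (hσ : IsSUGenerators σ) :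
    (blochMatrix U σ).PosSemidef := by
  rw [hσ.blochMatrix_eq]
  exact posSemidef_conjTranspose_mul_self _

theorem star_dotProduct_self {ι : Type*} [Fintype ι] (v : ι → ℂ) :
    star v ⬝ᵥ v = ((∑ j, ‖v j‖ ^ 2 : ℝ) : ℂ) := by
  simp only [dotProduct, Pi.star_apply]
  push_cast
  refine sum_congr rfl fun j _ => ?_
  rw [← starRingEnd_apply, Complex.conj_mul']

theorem IsSUGenerators.dotProduct_blochMatrix (hσ : IsSUGenerators σ)
    (v : Fin (N ^ 2 - 1) → ℂ) :
    star v ⬝ᵥ (blochMatrix U σ *ᵥ v) =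
      ((∑ k, ∑ i, ‖(blochCoord U σ *ᵥ v) (k, i)‖ ^ 2 : ℝ) : ℂ) := by
  rw [hσ.blochMatrix_eq, ← mulVec_mulVec, dotProduct_mulVec, ← star_mulVec, star_dotProduct_self,
    Fintype.sum_prod_type]

theorem IsSUGenerators.sum_normSq_blochCoord_le (hσ : IsSUGenerators σ)
    (v : Fin (N ^ 2 - 1) → ℂ) :
    ∑ k, ∑ i, ‖(blochCoord U σ *ᵥ v) (k, i)‖ ^ 2 ≤ 2 * L * ∑ j, ‖v j‖ ^ 2 := by
  have h : ∀ k, ∑ i, ‖(blochCoord U σ *ᵥ v) (k, i)‖ ^ 2 ≤ 2 * ∑ j, ‖v j‖ ^ 2 := by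
    intro k
    simp only [blochCoord_mulVec]
    refine (sum_normSq_diag_le _).trans (le_of_eq ?_)
    have e : ((U k : Matrix (Fin N) (Fin N) ℂ) * blochSum σ v *
        (U k : Matrix (Fin N) (Fin N) ℂ)ᴴ)ᴴ * ((U k : Matrix (Fin N) (Fin N) ℂ) * blochSum σ v *
        (U k : Matrix (Fin N) (Fin N) ℂ)ᴴ) = (U k : Matrix (Fin N) (Fin N) ℂ) *
        ((blochSum σ v)ᴴ * blochSum σ v) * (U k : Matrix (Fin N) (Fin N) ℂ)ᴴ := by
      simp only [conjTranspose_mul, conjTranspose_conjTranspose, Matrix.mul_assoc]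
      rw [← Matrix.mul_assoc (U k : Matrix (Fin N) (Fin N) ℂ)ᴴ (U k : Matrix (Fin N) (Fin N) ℂ),
        unitary_conjTranspose_mul, Matrix.one_mul]
    rw [e]
    have := sum_unitary_conj_diag (U k) ((blochSum σ v)ᴴ * blochSum σ v)
    rw [show trace _ = _ from this, hσ.trace_conjTranspose_blochSum_mul, Complex.ofReal_re]
  calc _ ≤ ∑ _k : Fin L, 2 * ∑ j, ‖v j‖ ^ 2 := sum_le_sum fun k _ => h k
    _ = _ := by simp; ring

open scoped MatrixOrder in
theorem IsSUGenerators.mul_le_sum_normSq_blochCoord (hσ : IsSUGenerators σ) {c : ℝ}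
    (hc : ∀ x ∈ spectrum ℝ (blochMatrix U σ), c ≤ x) (v : Fin (N ^ 2 - 1) → ℂ) :
    c * ∑ j, ‖v j‖ ^ 2 ≤ ∑ k, ∑ i, ‖(blochCoord U σ *ᵥ v) (k, i)‖ ^ 2 := by
  have hsa : IsSelfAdjoint (blochMatrix U σ) := hσ.posSemidef_blochMatrix.isHermitian
  have h := (algebraMap_le_iff_le_spectrum hsa).2 hc
  rw [Matrix.le_iff] at h
  have h2 := h.dotProduct_mulVec_nonneg v
  rw [sub_mulVec, dotProduct_sub, hσ.dotProduct_blochMatrix, Algebra.algebraMap_eq_smul_one,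
    smul_mulVec, one_mulVec, dotProduct_smul, star_dotProduct_self, Complex.real_smul] at h2
  norm_cast at h2
  linarith

open scoped MatrixOrder in
theorem IsSUGenerators.sum_normSq_blochCoord_le_mul (hσ : IsSUGenerators σ) {c : ℝ}
    (hc : ∀ x ∈ spectrum ℝ (blochMatrix U σ), x ≤ c) (v : Fin (N ^ 2 - 1) → ℂ) :
    ∑ k, ∑ i, ‖(blochCoord U σ *ᵥ v) (k, i)‖ ^ 2 ≤ c * ∑ j, ‖v j‖ ^ 2 := by
  have hsa : IsSelfAdjoint (blochMatrix U σ) := hσ.posSemidef_blochMatrix.isHermitian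
  have h := (le_algebraMap_iff_spectrum_le hsa).2 hc
  rw [Matrix.le_iff] at h
  have h2 := h.dotProduct_mulVec_nonneg v
  rw [sub_mulVec, dotProduct_sub, hσ.dotProduct_blochMatrix, Algebra.algebraMap_eq_smul_one,
    smul_mulVec, one_mulVec, dotProduct_smul, star_dotProduct_self, Complex.real_smul] at h2
  norm_cast at h2
  linarith

open scoped MatrixOrder in
theorem IsSUGenerators.nonneg_of_mem_spectrum (hσ : IsSUGenerators σ) {x : ℝ}
    (hx : x ∈ spectrum ℝ (blochMatrix U σ)) : 0 ≤ x := by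
  have hsa : IsSelfAdjoint (blochMatrix U σ) := hσ.posSemidef_blochMatrix.isHermitian
  refine (algebraMap_le_iff_le_spectrum (r := (0 : ℝ)) hsa).1 ?_ x hx
  rw [map_zero, Matrix.nonneg_iff_posSemidef]
  exact hσ.posSemidef_blochMatrix

open scoped MatrixOrder in
theorem IsSUGenerators.le_of_mem_spectrum (hσ : IsSUGenerators σ) {x : ℝ}
    (hx : x ∈ spectrum ℝ (blochMatrix U σ)) : x ≤ 2 * L := by
  have hsa : IsSelfAdjoint (blochMatrix U σ) := hσ.posSemidef_blochMatrix.isHermitian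
  refine (le_algebraMap_iff_spectrum_le (r := (2 * L : ℝ)) hsa).1 ?_ x hx
  rw [Matrix.le_iff]
  refine PosSemidef.of_dotProduct_mulVec_nonneg ?_ fun v => ?_
  · exact (IsSelfAdjoint.algebraMap _ (IsSelfAdjoint.all _)).sub hsa
  · rw [sub_mulVec, dotProduct_sub, hσ.dotProduct_blochMatrix, Algebra.algebraMap_eq_smul_one,
      smul_mulVec, one_mulVec, dotProduct_smul, star_dotProduct_self, Complex.real_smul]
    have := hσ.sum_normSq_blochCoord_le (U := U) v
    norm_cast
    push_cast
    linarith

theorem IsSUGenerators.finite_spectrum (hσ : IsSUGenerators σ) :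
    (spectrum ℝ (blochMatrix U σ)).Finite := by
  rw [hσ.posSemidef_blochMatrix.isHermitian.spectrum_real_eq_range_eigenvalues]
  exact Set.finite_range _

theorem IsSUGenerators.nonempty_spectrum (hσ : IsSUGenerators σ) (hN : 2 ≤ N) :
    (spectrum ℝ (blochMatrix U σ)).Nonempty := by
  rw [hσ.posSemidef_blochMatrix.isHermitian.spectrum_real_eq_range_eigenvalues]
  have : 2 ^ 2 ≤ N ^ 2 := Nat.pow_le_pow_left hN 2
  exact ⟨_, ⟨⟨0, by omega⟩, rfl⟩⟩

theorem IsSUGenerators.isLeast_eigMin (hσ : IsSUGenerators σ) (hN : 2 ≤ N) :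
    IsLeast (spectrum ℝ (blochMatrix U σ)) (eigMin U σ) :=
  ⟨(hσ.nonempty_spectrum hN).csInf_mem hσ.finite_spectrum,
    fun _ hx => csInf_le hσ.finite_spectrum.bddBelow hx⟩

theorem IsSUGenerators.isGreatest_eigMax (hσ : IsSUGenerators σ) (hN : 2 ≤ N) :
    IsGreatest (spectrum ℝ (blochMatrix U σ)) (eigMax U σ) :=
  ⟨(hσ.nonempty_spectrum hN).csSup_mem hσ.finite_spectrum,
    fun _ hx => le_csSup hσ.finite_spectrum.bddAbove hx⟩

theorem IsSUGenerators.zero_mem_spectrum_iff (hσ : IsSUGenerators σ) :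
    0 ∈ spectrum ℝ (blochMatrix U σ) ↔ ∃ v ≠ 0, blochCoord U σ *ᵥ v = 0 := by
  rw [spectrum.zero_mem_iff, Matrix.isUnit_iff_isUnit_det, isUnit_iff_ne_zero, not_not,
    ← exists_mulVec_eq_zero_iff]
  refine exists_congr fun v => and_congr_right fun _ => ?_
  rw [hσ.blochMatrix_eq, ← mulVec_mulVec]
  refine ⟨fun h => ?_, fun h => by rw [h, mulVec_zero]⟩
  rw [← dotProduct_star_self_eq_zero, star_mulVec, ← dotProduct_mulVec, h,
    dotProduct_zero]

/-- In each basis the diagonal entries of a traceless matrix sum to zero, so `C v = 0` amounts to `L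
(N-1) ≤ N² - N < N² - 1` linear conditions on `v`. -/
theorem IsSUGenerators.eigMin_eq_zero (hσ : IsSUGenerators σ) (hN : 2 ≤ N) (hLN : L ≤ N) :
    eigMin U σ = 0 := by
  refine le_antisymm ((hσ.isLeast_eigMin hN).2 (hσ.zero_mem_spectrum_iff.2 ?_))
    (hσ.nonneg_of_mem_spectrum (hσ.isLeast_eigMin hN).1)
  obtain ⟨n, rfl⟩ : ∃ n, N = n + 1 := ⟨N - 1, by omega⟩
  let T : (Fin ((n + 1) ^ 2 - 1) → ℂ) →ₗ[ℂ] (Fin L × Fin n → ℂ) :=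
    (LinearMap.funLeft ℂ ℂ fun x : Fin L × Fin n => (x.1, x.2.castSucc)) ∘ₗ
      (blochCoord U σ).mulVecLin
  have hker : LinearMap.ker T ≠ ⊥ := by
    apply LinearMap.ker_ne_bot_of_finrank_lt
    simp only [Module.finrank_fintype_fun_eq_card, Fintype.card_prod, Fintype.card_fin]
    have : L * n ≤ (n + 1) * n := Nat.mul_le_mul_right n hLN
    have e : (n + 1) ^ 2 = (n + 1) * n + n + 1 := by ring
    omega
  obtain ⟨v, hv, hv0⟩ := Submodule.exists_mem_ne_zero_of_ne_bot hker
  refine ⟨v, hv0, ?_⟩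
  rw [LinearMap.mem_ker] at hv
  have h1 : ∀ k (i : Fin n), (blochCoord U σ *ᵥ v) (k, i.castSucc) = 0 :=
    fun k i => congrFun hv (k, i)
  have h2 : ∀ k, (blochCoord U σ *ᵥ v) (k, Fin.last n) = 0 := by
    intro k
    have : ∑ i, (blochCoord U σ *ᵥ v) (k, i) = 0 := by
      simp only [blochCoord_mulVec]
      rw [sum_unitary_conj_diag, hσ.trace_blochSum]
    rw [Fin.sum_univ_castSucc] at this
    simpa [h1] using this
  funext ⟨k, i⟩
  refine Fin.lastCases (h2 k) (fun i => h1 k i) i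

theorem unitary_conj_vecMulVec_diag (V : Matrix.unitaryGroup (Fin N) ℂ)
    (ψ : EuclideanSpace ℂ (Fin N)) (i : Fin N) :
    ((V : Matrix (Fin N) (Fin N) ℂ) * vecMulVec ψ.ofLp (star ψ.ofLp) *
      (V : Matrix (Fin N) (Fin N) ℂ)ᴴ) i i = (outcomeProb V ψ i : ℂ) := by
  rw [mul_vecMulVec, vecMulVec_mul, ← star_mulVec, vecMulVec_apply, outcomeProb, Pi.star_apply,
    ← starRingEnd_apply, Complex.mul_conj']
  norm_cast

theorem trace_vecMulVec_self (ψ : EuclideanSpace ℂ (Fin N)) (hψ : ‖ψ‖ = 1) :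
    (vecMulVec ψ.ofLp (star ψ.ofLp)).trace = 1 := by
  rw [trace_vecMulVec, dotProduct_comm, star_dotProduct_self, ← EuclideanSpace.norm_sq_eq, hψ]
  simp

theorem sum_outcomeProb (V : Matrix.unitaryGroup (Fin N) ℂ) (ψ : EuclideanSpace ℂ (Fin N))
    (hψ : ‖ψ‖ = 1) : ∑ i, outcomeProb V ψ i = 1 := by
  have := sum_unitary_conj_diag V (vecMulVec ψ.ofLp (star ψ.ofLp))
  simp only [unitary_conj_vecMulVec_diag, trace_vecMulVec_self ψ hψ] at this
  exact_mod_cast this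

theorem outcomeProb_mem_stdSimplex (V : Matrix.unitaryGroup (Fin N) ℂ)
    (ψ : EuclideanSpace ℂ (Fin N)) (hψ : ‖ψ‖ = 1) :
    outcomeProb V ψ ∈ stdSimplex ℝ (Fin N) :=
  ⟨fun i => by rw [outcomeProb]; positivity, sum_outcomeProb V ψ hψ⟩

/-- The vector `v` holds the coordinates of `ρ - 1/N`, so it depends on the state but not on the
bases; its length comes from `Tr (ρ - 1/N)² = 1 - 1/N`. -/
theorem IsSUGenerators.exists_bloch_vector (hσ : IsSUGenerators σ) (hN : 2 ≤ N)
    (ψ : EuclideanSpace ℂ (Fin N)) (hψ : ‖ψ‖ = 1) :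
    ∃ v : Fin (N ^ 2 - 1) → ℂ, ∑ j, ‖v j‖ ^ 2 = ((N : ℝ) - 1) / (2 * N) ∧
      ∀ U : Fin L → Matrix.unitaryGroup (Fin N) ℂ,
        ∑ k, ∑ i, outcomeProb (U k) ψ i ^ 2 =
          L / N + ∑ k, ∑ i, ‖(blochCoord U σ *ᵥ v) (k, i)‖ ^ 2 := by
  have hN0 : (N : ℝ) ≠ 0 := by exact_mod_cast (by omega : N ≠ 0)
  have hNC : (N : ℂ) ≠ 0 := by exact_mod_cast (by omega : N ≠ 0)
  set ρ : Matrix (Fin N) (Fin N) ℂ := vecMulVec ψ.ofLp (star ψ.ofLp) with hρ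
  have htr : ρ.trace = 1 := trace_vecMulVec_self ψ hψ
  have hρH : ρᴴ = ρ := by rw [hρ, conjTranspose_vecMulVec, star_star]
  have hρρ : ρ * ρ = ρ := by
    rw [hρ, vecMulVec_mul_vecMulVec]
    have : star ψ.ofLp ⬝ᵥ ψ.ofLp = 1 := by
      rw [dotProduct_comm, ← trace_vecMulVec]; exact htr
    simp [this]
  obtain ⟨v, hv⟩ := hσ.exists_blochSum_eq (by omega) (A := ρ - (N : ℂ)⁻¹ • 1) (by
    rw [trace_sub, htr, trace_smul, trace_one]; simp [hNC])
  refine ⟨v, ?_, fun U => ?_⟩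
  · have h := hσ.trace_conjTranspose_blochSum_mul v
    rw [← hv, conjTranspose_sub, conjTranspose_smul, hρH, conjTranspose_one] at h
    simp only [sub_mul, mul_sub, hρρ, smul_mul_assoc, mul_smul_comm, Matrix.one_mul,
      Matrix.mul_one, trace_sub, trace_smul, htr, trace_one, smul_eq_mul, Fintype.card_fin] at h
    have h' : ((1 - (N : ℝ)⁻¹ : ℝ) : ℂ) = ((2 * ∑ j, ‖v j‖ ^ 2 : ℝ) : ℂ) := by
      rw [← h]; simp; field_simp; ring
    have h2 : (1 - (N : ℝ)⁻¹) = 2 * ∑ j, ‖v j‖ ^ 2 := by exact_mod_cast h'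
    field_simp at h2 ⊢
    linarith
  · have hk : ∀ k i, ‖(blochCoord U σ *ᵥ v) (k, i)‖ ^ 2 =
        (outcomeProb (U k) ψ i - (N : ℝ)⁻¹) ^ 2 := by
      intro k i
      have : (blochCoord U σ *ᵥ v) (k, i) = ((outcomeProb (U k) ψ i - (N : ℝ)⁻¹ : ℝ) : ℂ) := by
        rw [blochCoord_mulVec, ← hv, mul_sub, sub_mul, Matrix.sub_apply, unitary_conj_vecMulVec_diag,
          mul_smul_comm, smul_mul_assoc, Matrix.mul_one, unitary_mul_conjTranspose]
        simp
      rw [this, Complex.norm_real, Real.norm_eq_abs, sq_abs]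
    have hs : ∀ k, ∑ i, (outcomeProb (U k) ψ i - (N : ℝ)⁻¹) ^ 2 =
        ∑ i, outcomeProb (U k) ψ i ^ 2 - 1 / N := by
      intro k
      have e : ∀ i, (outcomeProb (U k) ψ i - (N : ℝ)⁻¹) ^ 2 = outcomeProb (U k) ψ i ^ 2 -
        2 * (N : ℝ)⁻¹ * outcomeProb (U k) ψ i + (N : ℝ)⁻¹ ^ 2 := fun i => by ring
      simp only [e, sum_add_distrib, sum_sub_distrib, ← mul_sum, sum_outcomeProb (U k) ψ hψ,
        sum_const, card_univ, Fintype.card_fin, nsmul_eq_mul]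
      field_simp
      ring
    simp only [hk, hs, sum_sub_distrib, sum_const, card_univ, Fintype.card_fin, nsmul_eq_mul]
    ring

end Bloch

/-! ### Qubit bases with invertible `M`. -/

section Pauli

/-- The Pauli matrices. -/
def pauli (j : Fin (2 ^ 2 - 1)) : Matrix (Fin 2) (Fin 2) ℂ :=
  (![!![0, 1; 1, 0], !![0, -Complex.I; Complex.I, 0], !![1, 0; 0, -1]] :
    Fin 3 → Matrix (Fin 2) (Fin 2) ℂ) j

theorem isSUGenerators_pauli : IsSUGenerators pauli where
  isHermitian := by
    change ∀ j : Fin 3, _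
    intro j
    fin_cases j <;> ext a b <;> fin_cases a <;> fin_cases b <;> simp [pauli]
  trace_eq_zero := by
    change ∀ j : Fin 3, _
    intro j
    fin_cases j <;> simp [pauli, trace_fin_two]
  trace_mul := by
    change ∀ i j : Fin 3, _
    intro i j
    fin_cases i <;> fin_cases j <;> simp [pauli, trace_fin_two] <;> norm_num

theorem blochSum_pauli (v : Fin (2 ^ 2 - 1) → ℂ) :
    blochSum pauli v = !![v (2 : Fin 3), v (0 : Fin 3) - Complex.I * v (1 : Fin 3);
      v (0 : Fin 3) + Complex.I * v (1 : Fin 3), -v (2 : Fin 3)] := by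
  have : blochSum pauli v = v (0 : Fin 3) • pauli (0 : Fin 3) +
      v (1 : Fin 3) • pauli (1 : Fin 3) + v (2 : Fin 3) • pauli (2 : Fin 3) :=
    Fin.sum_univ_three fun j : Fin 3 => v j • pauli j
  rw [this]
  ext a b
  fin_cases a <;> fin_cases b <;> simp [pauli] <;> ring

/-- A unitary that tilts the computational basis towards the first Bloch axis. -/
def tiltX : Matrix.unitaryGroup (Fin 2) ℂ :=
  ⟨!![3 / 5, 4 / 5; -4 / 5, 3 / 5], by
    rw [Matrix.mem_unitaryGroup_iff]
    ext a b
    fin_cases a <;> fin_cases b <;> simp [Matrix.mul_apply, star_apply, Complex.conj_ofNat] <;>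
      norm_num⟩

/-- A unitary that tilts the computational basis towards the second Bloch axis. -/
def tiltY : Matrix.unitaryGroup (Fin 2) ℂ :=
  ⟨!![3 / 5, 4 / 5 * Complex.I; 4 / 5 * Complex.I, 3 / 5], by
    rw [Matrix.mem_unitaryGroup_iff]
    ext a b
    fin_cases a <;> fin_cases b <;> simp [Matrix.mul_apply, star_apply, Complex.conj_ofNat] <;>
      ring_nf <;> norm_num⟩

/-- `L ≥ 3` bases of `ℂ²` whose Bloch vectors span the Bloch space. -/
def tiltedBases (L : ℕ) (k : Fin L) : Matrix.unitaryGroup (Fin 2) ℂ :=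
  if (k : ℕ) = 0 then 1 else if (k : ℕ) = 1 then tiltX else tiltY

theorem eigMin_tiltedBases_pos {L : ℕ} (hL : 3 ≤ L) : 0 < eigMin (tiltedBases L) pauli := by
  have hmin := isSUGenerators_pauli.isLeast_eigMin (U := tiltedBases L) le_rfl
  refine lt_of_le_of_ne (isSUGenerators_pauli.nonneg_of_mem_spectrum hmin.1) fun h => ?_
  have h0 := hmin.1
  rw [← h, isSUGenerators_pauli.zero_mem_spectrum_iff] at h0
  obtain ⟨v, hv0, hv⟩ := h0
  apply hv0
  -- One outcome per basis is enough: the first three bases give a triangular system whose entries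
  -- determine `v 2`, then `v 0`, then `v 1`, with coefficients `±24/25` from the 3-4-5 rotations.
  have key : ∀ k, ((tiltedBases L k : Matrix (Fin 2) (Fin 2) ℂ) * blochSum pauli v *
      (tiltedBases L k : Matrix (Fin 2) (Fin 2) ℂ)ᴴ) 0 0 = 0 := by
    intro k; rw [← blochCoord_mulVec, hv]; rfl
  have k0 := key ⟨0, by omega⟩
  have k1 := key ⟨1, by omega⟩
  have k2 := key ⟨2, by omega⟩
  simp [tiltedBases, tiltX, tiltY, blochSum_pauli, Matrix.mul_apply, Complex.conj_ofNat, Fin.sum_univ_two]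
    at k0 k1 k2
  have h2 : v (2 : Fin 3) = 0 := k0
  have h0 : v (0 : Fin 3) = 0 := by
    rw [h2] at k1; linear_combination (25 / 24 : ℂ) * k1
  have h1 : v (1 : Fin 3) = 0 := by
    rw [h2, h0] at k2
    linear_combination (-25 / 24 : ℂ) * k2 + v (1 : Fin 3) * Complex.I_sq
  funext j
  revert j
  change ∀ j : Fin 3, _
  intro j
  fin_cases j
  exacts [h0, h1, h2]

end Pauli

end QuantumCertainty
end

noncomputable section
namespace QuantumCertainty

open Finset Real

/-! ### The expression for `B_min`. -/

theorem lowerEntropyBound_nonneg {c : ℝ} (hc : 0 < c) : 0 ≤ lowerEntropyBound c := by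
  have h1 : ((⌊c⁻¹⌋₊ : ℕ) : ℝ) ≤ c⁻¹ := Nat.floor_le (inv_nonneg.2 hc.le)
  have h2 : c⁻¹ < (⌊c⁻¹⌋₊ : ℕ) + 1 := Nat.lt_floor_add_one _
  have h3 : (0 : ℝ) ≤ log ((⌊c⁻¹⌋₊ : ℕ) : ℝ) := log_natCast_nonneg _
  have h4 : (0 : ℝ) ≤ log (((⌊c⁻¹⌋₊ : ℕ) : ℝ) + 1) := by exact_mod_cast log_natCast_nonneg _
  have h5 : 0 ≤ c⁻¹ - (⌊c⁻¹⌋₊ : ℕ) := by linarith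
  have h6 : 0 ≤ 1 - (c⁻¹ - (⌊c⁻¹⌋₊ : ℕ)) := by linarith
  simp only [lowerEntropyBound]
  positivity

/-- The lower bound is the chord of `x ↦ -log x` between `1 / (K + 1)` and `1 / K`. -/
theorem lowerEntropyBound_eq {c : ℝ} (hc : 0 < c) (hc1 : c ≤ 1) :
    1 ≤ ⌊c⁻¹⌋₊ ∧ ∀ β : ℝ, β = (⌊c⁻¹⌋₊ : ℝ) * (⌊c⁻¹⌋₊ + 1) * log ((⌊c⁻¹⌋₊ + 1) / ⌊c⁻¹⌋₊) →
      lowerEntropyBound c = log ⌊c⁻¹⌋₊ + β / ⌊c⁻¹⌋₊ - β * c := by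
  have hK : 1 ≤ ⌊c⁻¹⌋₊ := Nat.one_le_floor_iff _ |>.2 (one_le_inv_iff₀.2 ⟨hc, hc1⟩)
  refine ⟨hK, ?_⟩
  rintro β rfl
  have hK0 : (0 : ℝ) < ⌊c⁻¹⌋₊ := by exact_mod_cast hK
  simp only [lowerEntropyBound]
  generalize ((⌊c⁻¹⌋₊ : ℕ) : ℝ) = K at hK0
  rw [log_div (by positivity) (by positivity)]
  field_simp
  ring

/-! ### The vector `Q` and its entropy. -/

section Vector

variable {N L : ℕ}

theorem sum_fin_ite_zero {n : ℕ} (hn : 1 ≤ n) (a b : ℝ) :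
    ∑ j : Fin n, (if (j : ℕ) = 0 then a else b) = a + ((n : ℝ) - 1) * b := by
  obtain ⟨m, rfl⟩ : ∃ m, n = m + 1 := ⟨n - 1, by omega⟩
  rw [Fin.sum_univ_succ]
  simp

theorem Qvec_eq_ite (r : ℝ) (j : Fin (L * N)) :
    Qvec N L r j = if (j : ℕ) = 0 then (1 + ((L : ℝ) * N - 1) * √r) / (L * N)
      else (1 - √r) / (L * N) := by
  rw [Qvec]; split_ifs <;> ring

theorem shannonEntropy_Qvec (h : 1 ≤ L * N) (r : ℝ) :
    shannonEntropy (Qvec N L r) = negMulLog ((1 + ((L : ℝ) * N - 1) * √r) / (L * N)) +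
      ((L : ℝ) * N - 1) * negMulLog ((1 - √r) / (L * N)) := by
  have := sum_fin_ite_zero h (negMulLog ((1 + ((L : ℝ) * N - 1) * √r) / (L * N)))
    (negMulLog ((1 - √r) / (L * N)))
  push_cast at this
  rw [← this, shannonEntropy]
  exact sum_congr rfl fun j _ => by rw [Qvec_eq_ite]; split_ifs <;> rfl

theorem Qvec_mem_stdSimplex (h : 1 ≤ L * N) {r : ℝ} (hr : r ≤ 1) :
    Qvec N L r ∈ stdSimplex ℝ (Fin (L * N)) := by
  have h' : (1 : ℝ) ≤ L * N := by exact_mod_cast h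
  have hs : 0 ≤ √r := sqrt_nonneg r
  have hs1 : √r ≤ 1 := sqrt_le_one.2 hr
  refine ⟨fun j => ?_, ?_⟩
  · rw [Qvec_eq_ite]
    split_ifs
    · have : 0 ≤ ((L : ℝ) * N - 1) * √r := mul_nonneg (by linarith) hs
      positivity
    · exact div_nonneg (by linarith) (by positivity)
  · simp only [Qvec_eq_ite]
    rw [sum_fin_ite_zero h]
    push_cast
    have h0 : (L : ℝ) * N ≠ 0 := by linarith
    generalize (L : ℝ) * N = n at h0
    field_simp
    ring

theorem shannonEntropy_Qvec_zero (h : 1 ≤ L * N) :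
    shannonEntropy (Qvec N L 0) = log ((L : ℝ) * N) := by
  have h' : (1 : ℝ) ≤ L * N := by exact_mod_cast h
  have h0 : (L : ℝ) * N ≠ 0 := by linarith
  rw [shannonEntropy_Qvec h, sqrt_zero, mul_zero, add_zero, sub_zero, negMulLog,
    log_div one_ne_zero h0, log_one]
  generalize (L : ℝ) * N = n at h0
  field_simp
  ring

theorem shannonEntropy_Qvec_le (h : 1 ≤ L * N) {r : ℝ} (hr : r ≤ 1) :
    shannonEntropy (Qvec N L r) ≤ log ((L : ℝ) * N) := by
  have : Nonempty (Fin (L * N)) := ⟨⟨0, by omega⟩⟩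
  simpa using shannonEntropy_le_log_card (Qvec_mem_stdSimplex h hr)

theorem shannonEntropy_Qvec_lt (h : 2 ≤ L * N) {r : ℝ} (hr0 : 0 < r) (hr : r ≤ 1) :
    shannonEntropy (Qvec N L r) < log ((L : ℝ) * N) := by
  have : Nonempty (Fin (L * N)) := ⟨⟨0, by omega⟩⟩
  have h' : (2 : ℝ) ≤ L * N := by exact_mod_cast h
  have hs : 0 < √r := sqrt_pos.2 hr0
  have hne : Qvec N L r ⟨0, by omega⟩ ≠ Qvec N L r ⟨1, by omega⟩ := by
    rw [Qvec_eq_ite, Qvec_eq_ite]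
    simp only [if_true, one_ne_zero, if_false]
    intro he
    rw [div_left_inj' (by linarith)] at he
    nlinarith
  simpa using shannonEntropy_lt_log_card (Qvec_mem_stdSimplex (by omega) hr) hne

/-- The left side of `hsq` is the index of coincidence of `Q`. The extremal lemma needs `0 < v < u`:
`r < 1` gives `0 < v`, while `r = 0`, where `u = v`, is the plain `log` bound. -/
theorem shannonEntropy_le_Qvec {ι : Type*} [Fintype ι] {q : ι → ℝ} (hq : q ∈ stdSimplex ℝ ι)
    (hcard : Fintype.card ι = L * N) (h : 2 ≤ L * N) {r : ℝ} (hr0 : 0 ≤ r) (hr1 : r < 1)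
    (hsq : (1 + ((L : ℝ) * N - 1) * r) / (L * N) ≤ ∑ i, q i ^ 2) :
    shannonEntropy q ≤ shannonEntropy (Qvec N L r) := by
  have : Nonempty ι := Fintype.card_pos_iff.1 (by omega)
  have hcard' : (Fintype.card ι : ℝ) = L * N := by rw [hcard]; push_cast; rfl
  have h' : (2 : ℝ) ≤ L * N := by exact_mod_cast h
  rcases hr0.eq_or_lt with rfl | hr0
  · rw [shannonEntropy_Qvec_zero (by omega), ← hcard']
    exact shannonEntropy_le_log_card hq
  · rw [shannonEntropy_Qvec (by omega), ← hcard']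
    rw [← hcard'] at h' hsq
    have hn : (0 : ℝ) < Fintype.card ι := by linarith
    have hs : 0 < √r := sqrt_pos.2 hr0
    have hs1 : √r < 1 := by rw [sqrt_lt' one_pos]; simpa using hr1
    have hss : √r ^ 2 = r := sq_sqrt hr0.le
    refine shannonEntropy_le_of_sum_sq hq (div_pos (by linarith) hn) ?_ ?_ ?_
    · rw [div_lt_div_iff_of_pos_right hn]
      nlinarith
    · field_simp
      ring
    · refine le_of_eq_of_le ?_ hsq
      have hr : 1 + ((Fintype.card ι : ℝ) - 1) * r =
          1 + ((Fintype.card ι : ℝ) - 1) * √r ^ 2 := by rw [hss]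
      rw [hr]
      field_simp
      ring

end Vector

/-! ### Parameter ranges and the two entropic relations. -/

section Bounds

variable {N L : ℕ} {U : Fin L → Matrix.unitaryGroup (Fin N) ℂ}
  {σ : Fin (N ^ 2 - 1) → Matrix (Fin N) (Fin N) ℂ}

theorem sq_mul_purityOf (hN : N ≠ 0) (hL : L ≠ 0) (m : ℝ) :
    (L : ℝ) ^ 2 * purityOf N L m = L / N + m * (((N : ℝ) - 1) / (2 * N)) := by
  have : (N : ℝ) ≠ 0 := by exact_mod_cast hN
  have : (L : ℝ) ≠ 0 := by exact_mod_cast hL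
  rw [purityOf]
  field_simp

theorem purityOf_pos (hN : 1 ≤ N) (hL : 1 ≤ L) {m : ℝ} (hm : 0 ≤ m) : 0 < purityOf N L m := by
  have hN1 : (1 : ℝ) ≤ N := by exact_mod_cast hN
  have hL1 : (1 : ℝ) ≤ L := by exact_mod_cast hL
  have : 0 ≤ (N : ℝ) - 1 := by linarith
  rw [purityOf]
  positivity

theorem mul_purityOf_le_one (hN : 1 ≤ N) (hL : 1 ≤ L) {m : ℝ} (hm : m ≤ 2 * L) :
    L * purityOf N L m ≤ 1 := by
  have hN1 : (1 : ℝ) ≤ N := by exact_mod_cast hN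
  have hL1 : (1 : ℝ) ≤ L := by exact_mod_cast hL
  have h := sq_mul_purityOf (N := N) (L := L) (by omega) (by omega) m
  have h2 : m * (((N : ℝ) - 1) / (2 * N)) ≤ 2 * L * (((N : ℝ) - 1) / (2 * N)) := by
    have : 0 ≤ (N : ℝ) - 1 := by linarith
    gcongr
  have h3 : (L : ℝ) / N + 2 * L * (((N : ℝ) - 1) / (2 * N)) = L := by field_simp; ring
  have h4 : (L : ℝ) * (L * purityOf N L m) ≤ L * 1 := by nlinarith
  exact le_of_mul_le_mul_left h4 (by linarith)

theorem rParam_eq (hN : 2 ≤ N) (hL : 1 ≤ L) :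
    rParam U σ = ((N : ℝ) - 1) * eigMin U σ / (2 * L * ((L : ℝ) * N - 1)) := by
  have hN1 : (2 : ℝ) ≤ N := by exact_mod_cast hN
  have hL1 : (1 : ℝ) ≤ L := by exact_mod_cast hL
  have : (L : ℝ) * N - 1 ≠ 0 := by nlinarith
  rw [rParam, purityMin, purityOf]
  field_simp
  ring

theorem one_add_mul_rParam (hN : 2 ≤ N) (hL : 1 ≤ L) :
    (1 + ((L : ℝ) * N - 1) * rParam U σ) / (L * N) = purityMin U σ := by
  have hN1 : (2 : ℝ) ≤ N := by exact_mod_cast hN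
  have hL1 : (1 : ℝ) ≤ L := by exact_mod_cast hL
  have : (L : ℝ) * N - 1 ≠ 0 := by nlinarith
  rw [rParam, mul_div_cancel₀ _ this]
  field_simp
  ring

theorem IsSUGenerators.eigMin_nonneg (hσ : IsSUGenerators σ) (hN : 2 ≤ N) : 0 ≤ eigMin U σ :=
  hσ.nonneg_of_mem_spectrum (hσ.isLeast_eigMin hN).1

theorem IsSUGenerators.eigMax_nonneg (hσ : IsSUGenerators σ) (hN : 2 ≤ N) : 0 ≤ eigMax U σ :=
  hσ.nonneg_of_mem_spectrum (hσ.isGreatest_eigMax hN).1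

theorem IsSUGenerators.rParam_nonneg (hσ : IsSUGenerators σ) (hN : 2 ≤ N) (hL : 1 ≤ L) :
    0 ≤ rParam U σ := by
  have hN1 : (2 : ℝ) ≤ N := by exact_mod_cast hN
  have hL1 : (1 : ℝ) ≤ L := by exact_mod_cast hL
  rw [rParam_eq hN hL]
  have h0 := hσ.eigMin_nonneg (U := U) hN
  exact div_nonneg (mul_nonneg (by linarith) h0) (mul_nonneg (by linarith) (by nlinarith))

/-- For `L = 1` the estimate `M ≤ 2L` yields only `r ≤ 1`; but `L ≤ N` forces `r = 0`, and for `L >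
N` that estimate is strict enough. -/
theorem IsSUGenerators.rParam_lt_one (hσ : IsSUGenerators σ) (hN : 2 ≤ N) (hL : 1 ≤ L) :
    rParam U σ < 1 := by
  have hN1 : (2 : ℝ) ≤ N := by exact_mod_cast hN
  rw [rParam_eq hN hL]
  rcases Nat.lt_or_ge N L with h | h
  · have hL1 : (2 : ℝ) ≤ L := by exact_mod_cast (by omega : 2 ≤ L)
    have h2 : eigMin U σ ≤ 2 * L := hσ.le_of_mem_spectrum (hσ.isLeast_eigMin hN).1
    have h3 : (0 : ℝ) < L * N - 1 := by nlinarith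
    rw [div_lt_one (by positivity)]
    calc ((N : ℝ) - 1) * eigMin U σ ≤ (N - 1) * (2 * L) := by gcongr; linarith
      _ < 2 * L * (L * N - 1) := by nlinarith
  · rw [hσ.eigMin_eq_zero hN h]
    simp

theorem rParam_pos_iff (hN : 2 ≤ N) (hL : 1 ≤ L) :
    0 < rParam U σ ↔ 0 < eigMin U σ := by
  have hN1 : (2 : ℝ) ≤ N := by exact_mod_cast hN
  have hL1 : (1 : ℝ) ≤ L := by exact_mod_cast hL
  have h3 : (0 : ℝ) < L * N - 1 := by nlinarith
  rw [rParam_eq hN hL, div_pos_iff_of_pos_right (by positivity),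
    mul_pos_iff_of_pos_left (by linarith)]

theorem IsSUGenerators.sum_sq_outcomeProb_bounds (hσ : IsSUGenerators σ) (hN : 2 ≤ N)
    (hL : 1 ≤ L) (ψ : EuclideanSpace ℂ (Fin N)) (hψ : ‖ψ‖ = 1) :
    (L : ℝ) ^ 2 * purityMin U σ ≤ ∑ k, ∑ i, outcomeProb (U k) ψ i ^ 2 ∧
      ∑ k, ∑ i, outcomeProb (U k) ψ i ^ 2 ≤ (L : ℝ) ^ 2 * purityMax U σ := by
  obtain ⟨v, hv, h⟩ := hσ.exists_bloch_vector (L := L) hN ψ hψ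
  rw [h U, purityMin, purityMax, sq_mul_purityOf (by omega) (by omega),
    sq_mul_purityOf (by omega) (by omega), ← hv]
  constructor
  · gcongr
    exact hσ.mul_le_sum_normSq_blochCoord (hσ.isLeast_eigMin hN).2 v
  · gcongr
    exact hσ.sum_normSq_blochCoord_le_mul (hσ.isGreatest_eigMax hN).2 v

/-- The same `K` and `β` serve every basis, so only the total of the indices of coincidence has to
be controlled, not each one; `β ≥ 0` allows replacing it by its upper bound. -/
theorem IsSUGenerators.Bmin_le_averageEntropy (hσ : IsSUGenerators σ) (hN : 2 ≤ N)
    (hL : 1 ≤ L) (ψ : EuclideanSpace ℂ (Fin N)) (hψ : ‖ψ‖ = 1) :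
    Bmin U σ ≤ averageEntropy U ψ := by
  have hL1 : (0 : ℝ) < L := by exact_mod_cast hL
  have hc : 0 < L * purityMax U σ :=
    mul_pos hL1 (purityOf_pos (by omega) hL (hσ.eigMax_nonneg hN))
  have hc1 : L * purityMax U σ ≤ 1 := mul_purityOf_le_one (by omega) hL
    (hσ.le_of_mem_spectrum (hσ.isGreatest_eigMax hN).1)
  obtain ⟨hK, heq⟩ := lowerEntropyBound_eq hc hc1
  set K := ⌊(L * purityMax U σ)⁻¹⌋₊ with hKdef
  obtain ⟨β, hβ⟩ : ∃ β : ℝ, β = (K : ℝ) * (K + 1) * log ((K + 1) / K) := ⟨_, rfl⟩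
  have hK0 : (0 : ℝ) < K := by exact_mod_cast hK
  have hβ0 : 0 ≤ β := by
    rw [hβ]
    have : 0 ≤ log (((K : ℝ) + 1) / K) := log_nonneg (by rw [le_div_iff₀ hK0]; linarith)
    positivity
  rw [Bmin, heq β hβ, averageEntropy, one_div, le_inv_mul_iff₀ hL1]
  have h := sum_le_sum fun k (_ : k ∈ univ) =>
    le_shannonEntropy (outcomeProb_mem_stdSimplex (U k) ψ hψ) hK hβ
  rw [sum_sub_distrib, ← mul_sum, sum_const, card_univ, Fintype.card_fin, nsmul_eq_mul] at h
  have h2 := mul_le_mul_of_nonneg_left (hσ.sum_sq_outcomeProb_bounds (U := U) hN hL ψ hψ).2 hβ0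
  linarith

/-- The joint distribution of a uniformly random measurement and its outcome. -/
def jointProb (U : Fin L → Matrix.unitaryGroup (Fin N) ℂ) (ψ : EuclideanSpace ℂ (Fin N))
    (x : Fin L × Fin N) : ℝ :=
  outcomeProb (U x.1) ψ x.2 / L

theorem jointProb_mem_stdSimplex (hL : 1 ≤ L) (ψ : EuclideanSpace ℂ (Fin N)) (hψ : ‖ψ‖ = 1) :
    jointProb U ψ ∈ stdSimplex ℝ (Fin L × Fin N) := by
  have hL1 : (0 : ℝ) < L := by exact_mod_cast hL
  refine ⟨fun x => div_nonneg ((outcomeProb_mem_stdSimplex _ ψ hψ).1 _) hL1.le, ?_⟩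
  simp only [jointProb, Fintype.sum_prod_type, ← sum_div, sum_outcomeProb _ ψ hψ]
  simp [hL1.ne']

theorem sum_sq_jointProb (ψ : EuclideanSpace ℂ (Fin N)) :
    ∑ x, jointProb U ψ x ^ 2 = (∑ k, ∑ i, outcomeProb (U k) ψ i ^ 2) / (L : ℝ) ^ 2 := by
  simp only [jointProb, Fintype.sum_prod_type, div_pow, ← sum_div]

/-- Chain rule: the uniform choice of the measurement contributes `log L`, which is the term
subtracted in `Bmax`. -/
theorem shannonEntropy_jointProb (hL : 1 ≤ L) (ψ : EuclideanSpace ℂ (Fin N)) (hψ : ‖ψ‖ = 1) :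
    shannonEntropy (jointProb U ψ) = averageEntropy U ψ + log L := by
  have hL1 : (0 : ℝ) < L := by exact_mod_cast hL
  have h : ∀ p : ℝ, negMulLog (p / L) = (1 / L) * negMulLog p + log L / L * p := by
    intro p
    rw [div_eq_mul_inv, negMulLog_mul, negMulLog, negMulLog, log_inv]
    field_simp
  simp only [shannonEntropy, jointProb, Fintype.sum_prod_type, h, sum_add_distrib, ← mul_sum,
    sum_outcomeProb _ ψ hψ, averageEntropy]
  simp [hL1.ne']

theorem IsSUGenerators.averageEntropy_le_Bmax (hσ : IsSUGenerators σ) (hN : 2 ≤ N)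
    (hL : 1 ≤ L) (ψ : EuclideanSpace ℂ (Fin N)) (hψ : ‖ψ‖ = 1) :
    averageEntropy U ψ ≤ Bmax U σ := by
  have hL1 : (0 : ℝ) < L := by exact_mod_cast hL
  have h := shannonEntropy_le_Qvec (N := N) (L := L)
    (jointProb_mem_stdSimplex (U := U) hL ψ hψ)
    (by simp) (by nlinarith) (hσ.rParam_nonneg (U := U) hN hL) (hσ.rParam_lt_one hN hL) (by
      rw [one_add_mul_rParam hN hL, sum_sq_jointProb, le_div_iff₀ (by positivity), mul_comm]
      exact (hσ.sum_sq_outcomeProb_bounds hN hL ψ hψ).1)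
  rw [shannonEntropy_jointProb hL ψ hψ] at h
  rw [Bmax]
  linarith

theorem IsSUGenerators.Bmax_le (hσ : IsSUGenerators σ) (hN : 2 ≤ N) (hL : 1 ≤ L) :
    Bmax U σ ≤ log N := by
  have hL1 : (L : ℝ) ≠ 0 := by exact_mod_cast (by omega : L ≠ 0)
  have hN1 : (N : ℝ) ≠ 0 := by exact_mod_cast (by omega : N ≠ 0)
  have h := shannonEntropy_Qvec_le (N := N) (L := L) (by nlinarith)
    (hσ.rParam_lt_one (U := U) hN hL).le
  rw [log_mul hL1 hN1] at h
  rw [Bmax]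
  linarith

theorem IsSUGenerators.Bmax_eq (hσ : IsSUGenerators σ) (hN : 2 ≤ N) (hL : 1 ≤ L)
    (h0 : eigMin U σ ≤ 0) : Bmax U σ = log N := by
  have hL1 : (L : ℝ) ≠ 0 := by exact_mod_cast (by omega : L ≠ 0)
  have hN1 : (N : ℝ) ≠ 0 := by exact_mod_cast (by omega : N ≠ 0)
  have hr : rParam U σ = 0 := by
    rw [rParam_eq hN hL, le_antisymm h0 (hσ.eigMin_nonneg hN)]; simp
  rw [Bmax, hr, shannonEntropy_Qvec_zero (by nlinarith), log_mul hL1 hN1]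
  ring

theorem IsSUGenerators.Bmax_lt_iff (hσ : IsSUGenerators σ) (hN : 2 ≤ N) (hL : 1 ≤ L) :
    Bmax U σ < log N ↔ 0 < eigMin U σ := by
  constructor
  · intro h
    by_contra! h0
    exact h.ne (hσ.Bmax_eq hN hL h0)
  · intro h0
    have hL1 : (L : ℝ) ≠ 0 := by exact_mod_cast (by omega : L ≠ 0)
    have hN1 : (N : ℝ) ≠ 0 := by exact_mod_cast (by omega : N ≠ 0)
    have h := shannonEntropy_Qvec_lt (N := N) (L := L) (by nlinarith)
      ((rParam_pos_iff (U := U) hN hL).2 h0) (hσ.rParam_lt_one (U := U) hN hL).le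
    rw [log_mul hL1 hN1] at h
    rw [Bmax]
    linarith

end Bounds

end QuantumCertainty
end

theorem theorem2 :
    (∀ (N L : ℕ), 2 ≤ N → 1 ≤ L →
      ∀ (U : Fin L → Matrix.unitaryGroup (Fin N) ℂ)
        (σ : Fin (N ^ 2 - 1) → Matrix (Fin N) (Fin N) ℂ),
        QuantumCertainty.IsSUGenerators σ →
        -- the quantities in the two bounds are well defined
        (IsLeast (spectrum ℝ (QuantumCertainty.blochMatrix U σ)) (QuantumCertainty.eigMin U σ) ∧
          IsGreatest (spectrum ℝ (QuantumCertainty.blochMatrix U σ))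
            (QuantumCertainty.eigMax U σ) ∧
          0 < QuantumCertainty.purityMax U σ ∧
          QuantumCertainty.rParam U σ ∈ Set.Icc (0 : ℝ) 1 ∧
          (∀ j, 0 ≤ QuantumCertainty.Qvec N L (QuantumCertainty.rParam U σ) j) ∧
          ∑ j, QuantumCertainty.Qvec N L (QuantumCertainty.rParam U σ) j = 1) ∧
        -- the uncertainty and the certainty relation
        (∀ ψ : EuclideanSpace ℂ (Fin N), ‖ψ‖ = 1 →
          0 ≤ QuantumCertainty.Bmin U σ ∧
          QuantumCertainty.Bmin U σ ≤ QuantumCertainty.averageEntropy U ψ ∧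
          QuantumCertainty.averageEntropy U ψ ≤ QuantumCertainty.Bmax U σ ∧
          QuantumCertainty.Bmax U σ ≤ Real.log N) ∧
        -- when the upper bound is nontrivial
        (QuantumCertainty.Bmax U σ < Real.log N ↔ 0 < QuantumCertainty.eigMin U σ) ∧
        (L ≤ N → QuantumCertainty.Bmax U σ = Real.log N)) ∧
    -- for every number `L ≥ 3` of measurements the upper bound is nontrivial for suitable bases
    (∀ L : ℕ, 3 ≤ L →
      ∃ (U : Fin L → Matrix.unitaryGroup (Fin 2) ℂ)
        (σ : Fin (2 ^ 2 - 1) → Matrix (Fin 2) (Fin 2) ℂ),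
        QuantumCertainty.IsSUGenerators σ ∧ QuantumCertainty.Bmax U σ < Real.log 2) := by
  refine ⟨fun N L hN hL U σ hσ => ⟨⟨hσ.isLeast_eigMin hN, hσ.isGreatest_eigMax hN,
    QuantumCertainty.purityOf_pos (by omega) hL (hσ.eigMax_nonneg hN),
    ⟨hσ.rParam_nonneg hN hL, (hσ.rParam_lt_one hN hL).le⟩,
    QuantumCertainty.Qvec_mem_stdSimplex (Nat.mul_pos hL (by omega))
      (hσ.rParam_lt_one hN hL).le⟩,
    fun ψ hψ => ⟨?_, hσ.Bmin_le_averageEntropy hN hL ψ hψ,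
      hσ.averageEntropy_le_Bmax hN hL ψ hψ, hσ.Bmax_le hN hL⟩,
    hσ.Bmax_lt_iff hN hL, fun h => hσ.Bmax_eq hN hL (hσ.eigMin_eq_zero hN h).le⟩,
    fun L hL => ⟨QuantumCertainty.tiltedBases L, QuantumCertainty.pauli,
      QuantumCertainty.isSUGenerators_pauli, ?_⟩⟩
  · exact QuantumCertainty.lowerEntropyBound_nonneg (mul_pos (by exact_mod_cast hL)
      (QuantumCertainty.purityOf_pos (by omega) hL (hσ.eigMax_nonneg hN)))
  · exact_mod_cast (QuantumCertainty.isSUGenerators_pauli.Bmax_lt_iff le_rfl (by omega)).2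
      (QuantumCertainty.eigMin_tiltedBases_pos hL)
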